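/- Let $k$ be a field of characteristic zero and let $\mathfrak g$, $V$ be $\mathbb Z$-graded vector spaces over $k$ (of arbitrary dimension), with $W[n]^i=W^{i+n}$. For a graded vector space $W$ let $W^*$ be its (pseudocompact) graded dual, $\hat S W^*$ the complete symmetric algebra, $\hat S_{\ge1}W^*$ its part without constant term, and $\overline{\mathrm{Der}}\,\hat S W^*$ the graded Lie algebra (under the graded commutator) of continuous derivations vanishing at zero; by duality its degree $p$ part is $\prod_{n\ge1}\mathrm{Hom}^p(S^nW,W)$. Let $\mathfrak{gl}(V)$ be the graded Lie algebra of graded endomorphisms of $V$, let $$\mathcal L=\mathcal L_{\mathrm{HLR}}(\mathfrak g,V)=\overline{\mathrm{Der}}\,\hat S\mathfrak g^*[-1]\ltimes\big(\hat S_{\ge1}\mathfrak g^*[-1]\otimes\mathfrak{gl}(V)\big)$$ be the semidirect product graded Lie algebra with $[\phi,x\otimes y]=\phi(x)\otimes y$ (tensor products with pseudocompact spaces being completed), regarded as a graded Lie subalgebra of $L=\overline{\mathrm{Der}}\,\hat S(\mathfrak g\oplus V)^*[-1]$, where $\mathfrak{gl}(V)$ acts on $V^*$ by the dual representation. Let $\mathfrak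 h=\mathrm{Hom}(\mathfrak g^*[-1],\hat S_{\ge1}V^*[-1])\subset L$ be the abelian subalgebra of derivations that vanish on $V^*[-1]$ and map $\mathfrak g^*[-1]$ to $\hat S_{\ge1}V^*[-1]$, and let $P$ be the projection of $L$ onto $\mathfrak h$ along its natural complement. For $T\in\mathfrak h^0$ put $\mathrm{ad}_T(x)=[x,T]$ and $e^{\mathrm{ad}_T}=\sum_{n\ge0}\frac1{n!}\mathrm{ad}_T^n$. Convergence is with respect to the filtration by the number of arguments of the corresponding multilinear maps. An $L_\infty$-algebra structure on $\mathfrak g$ is a degree $1$ element $m\in\overline{\mathrm{Der}}\,\hat S\mathfrak g^*[-1]$ with $m\circ m=0$; equivalently, a family of degree $1$ maps $\check m_n:S^n(\mathfrak g[1])\to\mathfrak g[1]$, $n\ge1$, with $$\sum_{i}\sum_{\sigma}\varepsilon(\sigma)\,\check m_{n-i+1}(\check m_i(x_{\sigma(1)},\dots,x_{\sigma(i)}),x_{\sigma(i+1)},\dots,x_{\sigma(n)})=0,$$ the inner sum being over $(i,n-i)$-unshuffles with Koszul signs. A representation of $(\mathfrak g,m)$ in $V$ is an $L_\infty$-map $\rho:\mathfrak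 g\to\mathfrak{gl}(V)$, where $\mathfrak{gl}(V)$ is an $L_\infty$-algebra with $\check m_2(x[1],y[1])=(-1)^{|x|}[x,y][1]$ as its only nonzero product; its components $S^n(\mathfrak g[1])\to\mathfrak{gl}(V)[1]$, $n\ge1$, form a degree $1$ element of $\hat S_{\ge1}\mathfrak g^*[-1]\otimes\mathfrak{gl}(V)$. A homotopy relative Rota-Baxter Lie algebra on $\mathfrak g$ and $V$ is a triple $(m,\rho,T)$ such that $m$ is an $L_\infty$-algebra structure on $\mathfrak g$, $\rho$ is a representation of $(\mathfrak g,m)$ in $V$, and $T\in\mathfrak h^0$ satisfies $P(e^{\mathrm{ad}_T}(m+\rho))=0$. Let $\mathcal L_{\mathrm{HRB}}(\mathfrak g,V)$ be the $L_\infty$-algebra $\mathcal L\oplus\mathfrak h[-1]$ with the graded symmetric products on $\mathcal L[1]\oplus\mathfrak h$ determined by $$\check m_2(Q[1],Q'[1])=(-1)^{|Q|}[Q,Q'][1],\qquad \check m_s(Q[1],\theta_1,\dots,\theta_{s-1})=P[\cdots[[Q,\theta_1],\theta_2],\cdots,\theta_{s-1}]\quad(s\ge2)$$ for homogeneous $Q,Q'\in\mathcal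 L$ and $\theta_i\in\mathfrak h$, all products not obtained from these by permuting arguments being zero. A Maurer-Cartan element of it is an element $\xi$ of degree $0$ of $\mathcal L[1]\oplus\mathfrak h$ for which $\sum_{i\ge1}\frac1{i!}\check m_i(\xi,\dots,\xi)$ converges to $0$. **Theorem.** Let $m\in(\overline{\mathrm{Der}}\,\hat S\mathfrak g^*[-1])^1$, $\rho\in(\hat S_{\ge1}\mathfrak g^*[-1]\otimes\mathfrak{gl}(V))^1$ and $T\in\mathrm{Hom}^0(\mathfrak g^*[-1],\hat S_{\ge1}V^*[-1])$, and let $\Phi=(m,\rho)$. Then $(m,\rho,T)$ is a homotopy relative Rota-Baxter Lie algebra on $\mathfrak g$ and $V$ if and only if $(\Phi[1],T)$ is a Maurer-Cartan element of the $L_\infty$-algebra $\mathcal L_{\mathrm{HRB}}(\mathfrak g,V)$. -/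

import Mathlib

namespace HRB

/-! ### Graded vector spaces and graded symmetric maps

A graded vector space is a family `W : ℤ → Type*` of `k`-modules (cohomological grading). -/

/-- The suspension `W[n]`, with `W[n]^i = W^{i+n}`. -/
abbrev Shift {X : Type*} (W : ℤ → X) (n : ℤ) : ℤ → X := fun i => W (i + n)

/-- Homogeneous elements of a graded vector space (together with a degree). -/
abbrev H (W : ℤ → Type*) := Σ i, W i

/-- Total degree of a list of homogeneous elements. -/
def deg {W : ℤ → Type*} (l : List (H W)) : ℤ := (l.map Sigma.fst).sum

/-- All the ways to distribute the members of the list `x₁, …, xₙ` into a pair of sublists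
`(x_S, x_{Sᶜ})`, i.e. all `(i, n-i)`-unshuffles for all `0 ≤ i ≤ n`, each with its Koszul sign
`ε`, which is determined by `x₁ ⋯ xₙ = ε • x_S x_{Sᶜ}` in the graded symmetric algebra. -/
def splits {W : ℤ → Type*} : List (H W) → List (ℤˣ × List (H W) × List (H W))
  | [] => [(1, [], [])]
  | a :: l =>
    (splits l).map (fun t => (t.1, a :: t.2.1, t.2.2)) ++
      (splits l).map
        (fun t => (Int.negOnePow (a.1 * deg t.2.1) * t.1, t.2.1, a :: t.2.2))

/-- `∑_S ε(S) F (x_S) (x_{Sᶜ})`, the sum over all unshuffles with Koszul signs. -/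
def unshuffleSum {W : ℤ → Type*} {M : Type*} [AddCommGroup M]
    (F : List (H W) → List (H W) → M) (l : List (H W)) : M :=
  ((splits l).map (fun t => t.1 • F t.2.1 t.2.2)).sum

/-- All the ways to distribute a list into `j` nonempty sublists (ordered), with Koszul signs:
the `(k₁, …, k_j)`-unshuffles with all `kᵢ ≥ 1`. -/
def blocks {W : ℤ → Type*} : ℕ → List (H W) → List (ℤˣ × List (List (H W)))
  | 0, [] => [(1, [])]
  | 0, _ :: _ => []
  | j + 1, l =>
    ((splits l).filter (fun t => !t.2.1.isEmpty)).flatMap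
      (fun t => (blocks j t.2.2).map (fun b => (t.1 * b.1, t.2.1 :: b.2)))

/-- Families `(fₙ)_{n ≥ 0}` of maps of `n` homogeneous arguments. The value is recorded
through its components in all degrees. -/
abbrev Coch (W W' : ℤ → Type*) := List (H W) → (j : ℤ) → W' j

/-- The family consists of multilinear, graded symmetric maps. -/
structure IsSym (k : Type*) [Field k] {W : ℤ → Type*} [∀ i, AddCommGroup (W i)]
    [∀ i, Module k (W i)] {M : Type*} [AddCommGroup M] [Module k M]
    (F : List (H W) → M) : Prop where
  add : ∀ (l₁ l₂ : List (H W)) (i : ℤ) (x y : W i),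
    F (l₁ ++ ⟨i, x + y⟩ :: l₂) = F (l₁ ++ ⟨i, x⟩ :: l₂) + F (l₁ ++ ⟨i, y⟩ :: l₂)
  smul : ∀ (l₁ l₂ : List (H W)) (i : ℤ) (c : k) (x : W i),
    F (l₁ ++ ⟨i, c • x⟩ :: l₂) = c • F (l₁ ++ ⟨i, x⟩ :: l₂)
  swap : ∀ (l₁ l₂ : List (H W)) (a b : H W),
    F (l₁ ++ a :: b :: l₂) = Int.negOnePow (a.1 * b.1) • F (l₁ ++ b :: a :: l₂)

/-! ### Closure lemmas -/

section lemmas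

variable {k : Type*} [Field k] {W : ℤ → Type*}
  {M N : Type*} [AddCommGroup M] [Module k M] [AddCommGroup N] [Module k N]

@[simp] theorem deg_nil : deg ([] : List (H W)) = 0 := rfl
@[simp] theorem deg_cons (a : H W) (l : List (H W)) : deg (a :: l) = a.1 + deg l := by
  simp [deg]
@[simp] theorem deg_append (l l' : List (H W)) : deg (l ++ l') = deg l + deg l' := by
  simp [deg]

theorem deg_of_mem_splits {l : List (H W)} {t : ℤˣ × List (H W) × List (H W)}
    (ht : t ∈ splits l) : deg t.2.1 + deg t.2.2 = deg l := by
  induction l generalizing t with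
  | nil => simp [splits] at ht; subst ht; simp
  | cons a l ih =>
    simp only [splits, List.mem_append, List.mem_map] at ht
    rcases ht with ⟨t', h, rfl⟩ | ⟨t', h, rfl⟩ <;> have := ih h <;> simp <;> omega

theorem units_smul_comm (s : ℤˣ) (c : k) (x : M) : s • c • x = c • s • x := by
  rcases Int.units_eq_one_or s with rfl | rfl <;> simp [Units.smul_def]

theorem map_units_smul (φ : M →ₗ[k] N) (s : ℤˣ) (x : M) : φ (s • x) = s • φ x := by
  rcases Int.units_eq_one_or s with rfl | rfl <;> simp [Units.smul_def]

@[simp] theorem unshuffleSum_nil (F : List (H W) → List (H W) → M) :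
    unshuffleSum F [] = F [] [] := by
  simp [unshuffleSum, splits]

theorem unshuffleSum_cons (F : List (H W) → List (H W) → M) (a : H W) (l : List (H W)) :
    unshuffleSum F (a :: l) = unshuffleSum (fun u v => F (a :: u) v) l +
      unshuffleSum (fun u v => Int.negOnePow (a.1 * deg u) • F u (a :: v)) l := by
  simp only [unshuffleSum, splits, List.map_append, List.map_map, List.sum_append]
  congr 3
  funext t
  simp only [Function.comp, smul_smul, mul_comm]

theorem unshuffleSum_apply {W' : ℤ → Type*} [∀ i, AddCommGroup (W' i)]
    (F : List (H W) → List (H W) → (j : ℤ) → W' j)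
    (l : List (H W)) (j : ℤ) : unshuffleSum F l j = unshuffleSum (fun u v => F u v j) l := by
  induction l generalizing F with
  | nil => simp
  | cons a l ih => simp only [unshuffleSum_cons, Pi.add_apply, ih, Pi.smul_apply]

theorem unshuffleSum_add (F G : List (H W) → List (H W) → M) (l : List (H W)) :
    unshuffleSum (fun u v => F u v + G u v) l = unshuffleSum F l + unshuffleSum G l := by
  simp [unshuffleSum, smul_add, List.sum_map_add]

theorem unshuffleSum_smul (c : k) (F : List (H W) → List (H W) → M) (l : List (H W)) :
    unshuffleSum (fun u v => c • F u v) l = c • unshuffleSum F l := by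
  simp only [unshuffleSum, units_smul_comm, List.smul_sum, List.map_map]
  rfl

theorem unshuffleSum_units_smul (s : ℤˣ) (F : List (H W) → List (H W) → M) (l : List (H W)) :
    unshuffleSum (fun u v => s • F u v) l = s • unshuffleSum F l := by
  simp only [unshuffleSum, List.smul_sum, List.map_map]
  congr 2
  funext t
  simp only [Function.comp, smul_smul, mul_comm]

theorem unshuffleSum_eq_zero (F : List (H W) → List (H W) → M) (l : List (H W))
    (h : ∀ u v, deg u + deg v = deg l → F u v = 0) : unshuffleSum F l = 0 := by
  unfold unshuffleSum
  apply List.sum_eq_zero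
  intro x hx
  obtain ⟨t, ht, rfl⟩ := List.mem_map.1 hx
  simp only [h _ _ (deg_of_mem_splits ht), smul_zero]

variable [∀ i, AddCommGroup (W i)] [∀ i, Module k (W i)]

theorem IsSym.zero_arg {F : List (H W) → M} (hF : IsSym k F) (l₁ l₂ : List (H W)) (i : ℤ) :
    F (l₁ ++ ⟨i, 0⟩ :: l₂) = 0 := by
  have := hF.smul l₁ l₂ i 0 0
  simpa using this

theorem IsSym.add' {F G : List (H W) → M} (hF : IsSym k F) (hG : IsSym k G) :
    IsSym k (fun l => F l + G l) where
  add l₁ l₂ i x y := by simp only [hF.add, hG.add]; abel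
  smul l₁ l₂ i c x := by simp only [hF.smul, hG.smul, smul_add]
  swap l₁ l₂ a b := by rw [hF.swap, hG.swap, smul_add]

theorem IsSym.linearMap {F : List (H W) → M} (hF : IsSym k F) (φ : M →ₗ[k] N) :
    IsSym k (fun l => φ (F l)) where
  add l₁ l₂ i x y := by simp only [hF.add, map_add]
  smul l₁ l₂ i c x := by simp only [hF.smul, map_smul]
  swap l₁ l₂ a b := by rw [hF.swap, map_units_smul]

theorem IsSym.units_smul {F : List (H W) → M} (hF : IsSym k F) (s : ℤˣ) :
    IsSym k (fun l => s • F l) where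
  add l₁ l₂ i x y := by simp only [hF.add, smul_add]
  smul l₁ l₂ i c x := by simp only [hF.smul, units_smul_comm]
  swap l₁ l₂ a b := by rw [hF.swap, smul_smul, smul_smul, mul_comm]

theorem IsSym.sign_smul {F : List (H W) → M} (hF : IsSym k F) (n : ℤ) :
    IsSym k (fun l => Int.negOnePow (n * deg l) • F l) where
  add l₁ l₂ i x y := by simp only [hF.add, smul_add, deg_append, deg_cons]
  smul l₁ l₂ i c x := by simp only [hF.smul, units_smul_comm, deg_append, deg_cons]
  swap l₁ l₂ a b := by
    rw [hF.swap, smul_smul, smul_smul, mul_comm]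
    simp only [deg_append, deg_cons, add_left_comm a.1 b.1]

theorem IsSym.cons {F : List (H W) → M} (hF : IsSym k F) (a : H W) :
    IsSym k (fun l => F (a :: l)) where
  add l₁ l₂ i x y := hF.add (a :: l₁) l₂ i x y
  smul l₁ l₂ i c x := hF.smul (a :: l₁) l₂ i c x
  swap l₁ l₂ b c := hF.swap (a :: l₁) l₂ b c

theorem IsSym.comp_deg {F : List (H W) → M} (hF : IsSym k F) (p : ℤ) (ψ : ℤ → M →ₗ[k] N) :
    IsSym k (fun u => ψ (deg u + p) (F u)) where
  add l₁ l₂ i x y := by simp only [deg_append, deg_cons, hF.add, map_add]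
  smul l₁ l₂ i c x := by simp only [deg_append, deg_cons, hF.smul, map_smul]
  swap l₁ l₂ a b := by
    simp only [deg_append, deg_cons, add_left_comm a.1 b.1]
    rw [hF.swap, map_units_smul]

/-- A symmetric family is linear in its first argument (helper). -/
def IsSym.consLinear {F : List (H W) → M} (hF : IsSym k F) (v : List (H W)) (d : ℤ) :
    ((j : ℤ) → W j) →ₗ[k] M where
  toFun w := F (⟨d, w d⟩ :: v)
  map_add' w w' := hF.add [] v d (w d) (w' d)
  map_smul' c w := hF.smul [] v d c (w d)

theorem IsSym.unshuffleSum {F : List (H W) → List (H W) → M}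
    (h₁ : ∀ v, IsSym k (fun u => F u v)) (h₂ : ∀ u, IsSym k (fun v => F u v)) :
    IsSym k (unshuffleSum F) where
  add l₁ l₂ i x y := by
    induction l₁ generalizing F with
    | nil =>
      simp only [List.nil_append, unshuffleSum_cons]
      have e1 : ∀ u v, F (⟨i, x + y⟩ :: u) v = F (⟨i, x⟩ :: u) v + F (⟨i, y⟩ :: u) v :=
        fun u v => (h₁ v).add [] u i x y
      have e2 : ∀ u v, F u (⟨i, x + y⟩ :: v) = F u (⟨i, x⟩ :: v) + F u (⟨i, y⟩ :: v) :=
        fun u v => (h₂ u).add [] v i x y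
      simp only [e1, e2, smul_add, unshuffleSum_add]
      abel
    | cons a l₁ ih =>
      simp only [List.cons_append, unshuffleSum_cons]
      rw [ih (fun v => (h₁ v).cons a) (fun u => h₂ (a :: u)),
        ih (fun v => (h₁ (a :: v)).sign_smul a.1) (fun u => ((h₂ u).cons a).units_smul _)]
      abel
  smul l₁ l₂ i c x := by
    induction l₁ generalizing F with
    | nil =>
      simp only [List.nil_append, unshuffleSum_cons]
      have e1 : ∀ u v, F (⟨i, c • x⟩ :: u) v = c • F (⟨i, x⟩ :: u) v :=
        fun u v => (h₁ v).smul [] u i c x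
      have e2 : ∀ u v, F u (⟨i, c • x⟩ :: v) = c • F u (⟨i, x⟩ :: v) :=
        fun u v => (h₂ u).smul [] v i c x
      simp only [e1, e2, units_smul_comm, unshuffleSum_smul, smul_add]
    | cons a l₁ ih =>
      simp only [List.cons_append, unshuffleSum_cons]
      rw [ih (fun v => (h₁ v).cons a) (fun u => h₂ (a :: u)),
        ih (fun v => (h₁ (a :: v)).sign_smul a.1) (fun u => ((h₂ u).cons a).units_smul _),
        smul_add]
  swap l₁ l₂ a b := by
    induction l₁ generalizing F with
    | nil =>
      simp only [List.nil_append, unshuffleSum_cons, deg_cons]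
      have e1 : ∀ u v, F (a :: b :: u) v = Int.negOnePow (a.1 * b.1) • F (b :: a :: u) v :=
        fun u v => (h₁ v).swap [] u a b
      have e2 : ∀ u v, F u (a :: b :: v) = Int.negOnePow (a.1 * b.1) • F u (b :: a :: v) :=
        fun u v => (h₂ u).swap [] v a b
      have e3 : ∀ u v, Int.negOnePow (a.1 * (b.1 + deg u)) • F (b :: u) (a :: v) =
          Int.negOnePow (a.1 * b.1) • Int.negOnePow (a.1 * deg u) • F (b :: u) (a :: v) := by
        intro u v
        rw [smul_smul, ← Int.negOnePow_add, mul_add]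
      have e4 : ∀ u v, Int.negOnePow (b.1 * deg u) • F (a :: u) (b :: v) =
          Int.negOnePow (a.1 * b.1) •
            Int.negOnePow (b.1 * (a.1 + deg u)) • F (a :: u) (b :: v) := by
        intro u v
        rw [smul_smul, ← Int.negOnePow_add]
        congr 1
        rw [Int.negOnePow_eq_iff]
        exact ⟨-(a.1 * b.1), by ring⟩
      have e6 : ∀ u v, Int.negOnePow (b.1 * deg u) • Int.negOnePow (a.1 * deg u) •
          F u (a :: b :: v) = Int.negOnePow (a.1 * b.1) • Int.negOnePow (a.1 * deg u) •
          Int.negOnePow (b.1 * deg u) • F u (b :: a :: v) := by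
        intro u v
        rw [e2]
        simp only [smul_smul]
        congr 1
        simp only [mul_comm, mul_assoc]
      simp only [e1, e3, e4, e6, unshuffleSum_units_smul, smul_add]
      abel
    | cons c l₁ ih =>
      simp only [List.cons_append, unshuffleSum_cons]
      rw [ih (fun v => (h₁ v).cons c) (fun u => h₂ (c :: u)),
        ih (fun v => (h₁ (c :: v)).sign_smul c.1) (fun u => ((h₂ u).cons c).units_smul _),
        smul_add]

end lemmas

/-! ### Graded spaces of symmetric maps, composition, brackets -/

section general

variable (k : Type*) [Field k] {W W' : ℤ → Type*} [∀ i, AddCommGroup (W i)]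
  [∀ i, Module k (W i)] [∀ i, AddCommGroup (W' i)] [∀ i, Module k (W' i)]

variable (W W') in
/-- `∏_{n ≥ 1} Hom^p (Sⁿ W, W')`: families of graded symmetric multilinear maps of degree `p`
in `n ≥ 1` arguments. By duality between discrete and pseudocompact graded vector spaces this is
the degree `p` part of the space of continuous linear maps `W'^* → Ŝ_{≥1} W^*`. For `W = W' = 𝔤[1]`
it is the degree `p` part of the space of continuous derivations of `Ŝ 𝔤^*[-1]` vanishing at zero,
and for `W = 𝔤[1]` and `W' = 𝔤𝔩(V)` it is the degree `p` part of `Ŝ_{≥1} 𝔤^*[-1] ⊗ 𝔤𝔩(V)`. -/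
def SHom (p : ℤ) : Submodule k (Coch W W') where
  carrier := {f | f [] = 0 ∧ (∀ l j, j ≠ deg l + p → f l j = 0) ∧ IsSym k f}
  zero_mem' := by
    refine ⟨rfl, fun _ _ _ => rfl, ⟨?_, ?_, ?_⟩⟩ <;> intros <;> simp
  add_mem' := by
    rintro f g ⟨f0, fh, fs⟩ ⟨g0, gh, gs⟩
    refine ⟨by simp [f0, g0], fun l j h => ?_, fs.add' gs⟩
    simp [fh l j h, gh l j h]
  smul_mem' := by
    rintro c f ⟨f0, fh, fs⟩
    refine ⟨by simp [f0], fun l j h => ?_, fs.linearMap (LinearMap.lsmul k _ c)⟩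
    simp [fh l j h]

/-- Insertion: `(f ∘ g)(x₁, …, xₙ) = ∑_S ε(S) f (g (x_S), x_{Sᶜ})`, where `g` has degree `q`. -/
def ins (q : ℤ) (f : Coch W W') (g : Coch W W) : Coch W W' :=
  unshuffleSum (fun u v => f (⟨deg u + q, g u (deg u + q)⟩ :: v))

variable {k}

theorem ins_mem {p q r : ℤ} (h : p + q = r) {f : Coch W W'} {g : Coch W W}
    (hf : f ∈ SHom k W W' p) (hg : g ∈ SHom k W W q) : ins q f g ∈ SHom k W W' r := by
  obtain ⟨f0, fh, fs⟩ := hf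
  obtain ⟨g0, gh, gs⟩ := hg
  refine ⟨?_, fun l j hj => ?_, IsSym.unshuffleSum
    (fun v => gs.comp_deg q (fs.consLinear v)) (fun u => fs.cons _)⟩
  · simp only [ins, unshuffleSum_nil, g0, Pi.zero_apply]
    exact fs.zero_arg [] [] _
  · rw [ins, unshuffleSum_apply]
    refine unshuffleSum_eq_zero _ _ (fun u v huv => fh _ _ ?_)
    simp only [deg_cons]
    omega

theorem units_smul_mem {M : Type*} [AddCommGroup M] [Module k M] (N : Submodule k M) (s : ℤˣ)
    {x : M} (hx : x ∈ N) : s • x ∈ N := by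
  rcases Int.units_eq_one_or s with rfl | rfl <;> simpa [Units.smul_def] using hx

/-- The graded commutator `[f, g] = f ∘ g - (-1)^{pq} g ∘ f` on `Der⁰ Ŝ W^*`
(derivations vanishing at zero). A continuous derivation `D` of degree `p` is identified with the
family `f` for which the restriction of `D` to `W^*` is `φ ↦ -(-1)^{p|φ|} φ ∘ f`; under this
identification the commutator bracket of derivations is the present bracket. -/
def bracket {p q r : ℤ} (h : p + q = r) (f : SHom k W W p) (g : SHom k W W q) : SHom k W W r :=
  ⟨ins q f.1 g.1 - Int.negOnePow (p * q) • ins p g.1 f.1,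
    sub_mem (ins_mem h f.2 g.2)
      (units_smul_mem _ _ (ins_mem (by rw [add_comm]; exact h) g.2 f.2))⟩

/-- `Σ_{i ≥ 1} ∑_S ε(S) m_{n-i+1} (m_i (x_S), x_{Sᶜ}) = 0`: the degree `1` derivation `m`
squares to zero, i.e. it is an `L∞`-structure. -/
def IsLInfinity (m : SHom k W W 1) : Prop := ∀ l : List (H W), ins 1 m.1 m.1 l = 0

/-- `f = (fₙ : Sⁿ W → W')_{n ≥ 1}`, of degree `0`, is an `L∞`-map between the `L∞`-algebras with
structure maps `m` on `W = 𝔤[1]` and `m'` on `W' = 𝔥[1]`: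
`∑_S ε(S) f_{n-i+1} (m_i (x_S), x_{Sᶜ}) =
∑_j (1/j!) ∑_{(S₁, …, S_j)} ε m'_j (f (x_{S₁}), …, f (x_{S_j}))` for all `n ≥ 1`. -/
def IsLInfinityMap (m : Coch W W) (m' : Coch W' W') (f : SHom k W W' 0) : Prop :=
  ∀ l : List (H W), l ≠ [] →
    ins 1 f.1 m l = ∑ j ∈ Finset.Icc 1 l.length, ((j.factorial : k)⁻¹) •
      ((blocks j l).map (fun t =>
        t.1 • m' (t.2.map (fun b => (⟨deg b, f.1 b (deg b)⟩ : H W'))))).sum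

/-- Convergence of a sequence in the topology defined by a descending filtration. -/
def ConvergesTo {M : Type*} [AddCommGroup M] [Module k M] (F : ℕ → Submodule k M)
    (s : ℕ → M) (x : M) : Prop := ∀ n, ∃ N, ∀ r ≥ N, s r - x ∈ F n

/-- `ξ ∈ 𝔤[1]^0` is a Maurer-Cartan element for the products `μ` on `W = 𝔤[1]`:
the series `∑_{i ≥ 1} (1/i!) μ_i (ξ, …, ξ)` converges with sum zero, with respect to a given
filtration of `W`. -/
def IsMC (F : (j : ℤ) → ℕ → Submodule k (W j)) (μ : Coch W W) (ξ : W 0) : Prop :=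
  ConvergesTo (F 1) (fun r => ∑ i ∈ Finset.Icc 1 r,
    ((i.factorial : k)⁻¹) • μ (List.replicate i ⟨0, ξ⟩) 1) 0

variable (k W W') in
/-- The order filtration: families whose components in fewer than `n` arguments vanish. -/
def orderFiltration (p : ℤ) (n : ℕ) : Submodule k (SHom k W W' p) where
  carrier := {f | ∀ l : List (H W), l.length < n → f.1 l = 0}
  zero_mem' _ _ := rfl
  add_mem' := by
    intro f g hf hg l hl
    simp [hf l hl, hg l hl]
  smul_mem' := by
    intro c f hf l hl
    simp [hf l hl]

end general

/-! ### The graded Lie algebra `𝔤𝔩(V)` -/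

section gl

variable (k : Type*) [Field k] (V : ℤ → Type*) [∀ i, AddCommGroup (V i)] [∀ i, Module k (V i)]

/-- `𝔤𝔩(V)^p = ∏_i Hom (V^i, V^{i+p})`. -/
def gl (p : ℤ) : Submodule k ((i j : ℤ) → V i →ₗ[k] V j) where
  carrier := {y | ∀ i j, j ≠ i + p → y i j = 0}
  zero_mem' _ _ _ := rfl
  add_mem' := by
    intro y z hy hz i j h
    simp [hy i j h, hz i j h]
  smul_mem' := by
    intro c y hy i j h
    simp [hy i j h]

/-- `𝔤𝔩(V)` as a graded vector space. -/
abbrev Gl : ℤ → Type _ := fun p => gl k V p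

variable {k V}

/-- Composition of homogeneous endomorphisms. -/
def glMul {p q r : ℤ} (h : p + q = r) (y : Gl k V p) (z : Gl k V q) : Gl k V r :=
  ⟨fun i j => (y.1 (i + q) j).comp (z.1 i (i + q)), by
    intro i j hj
    change (y.1 (i + q) j).comp (z.1 i (i + q)) = 0
    rw [y.2 (i + q) j (by omega), LinearMap.zero_comp]⟩

/-- The graded commutator `[y, z] = y z - (-1)^{pq} z y`. -/
def glBracket {p q r : ℤ} (h : p + q = r) (y : Gl k V p) (z : Gl k V q) : Gl k V r :=
  glMul h y z - Int.negOnePow (p * q) • glMul (by rw [add_comm]; exact h) z y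

variable (k V) in
/-- `𝔤𝔩(V)` as an `L∞`-algebra: the structure maps on `𝔤𝔩(V)[1]` are
`m₂ (y[1], z[1]) = (-1)^{|y|} [y, z][1]`, and the others vanish. -/
def glProducts : Coch (Shift (Gl k V) 1) (Shift (Gl k V) 1)
  | [a, b] => Pi.single (M := Shift (Gl k V) 1) (a.1 + b.1 + 1)
      (Int.negOnePow (a.1 + 1) • glBracket (by ring) a.2 b.2)
  | _ => 0

variable {W : ℤ → Type*} [∀ i, AddCommGroup (W i)] [∀ i, Module k (W i)]

/-- The product of `Ŝ_{≥1} W^* ⊗ 𝔤𝔩(V)`, on elements of degrees `p` and `q`: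
`(ρ ρ')(x₁, …, xₙ) = ∑_S ε(S) (-1)^{q |x_S|} ρ(x_S) ρ'(x_{Sᶜ})`. -/
def convRaw (p q : ℤ) (ρ ρ' : Coch W (Gl k V)) : Coch W (Gl k V) :=
  unshuffleSum (fun u v => Int.negOnePow (q * deg u) •
    Pi.single (M := Gl k V) ((deg u + p) + (deg v + q))
      (glMul rfl (ρ u (deg u + p)) (ρ' v (deg v + q))))

/-- Composition as a bilinear map (helper). -/
def glMulₗ (a b : ℤ) : Gl k V a →ₗ[k] Gl k V b →ₗ[k] ((j : ℤ) → Gl k V j) :=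
  LinearMap.mk₂ k (fun y z => Pi.single (M := Gl k V) (a + b) (glMul rfl y z))
    (by
      intro y y' z
      rw [← Pi.single_add]
      congr 1)
    (by
      intro c y z
      rw [← Pi.single_smul]
      congr 1)
    (by
      intro y z z'
      rw [← Pi.single_add]
      congr 1
      ext i j x
      simp [glMul])
    (by
      intro c y z
      rw [← Pi.single_smul]
      congr 1
      ext i j x
      simp [glMul])

theorem convRaw_mem {p q r : ℤ} (h : p + q = r) {ρ ρ' : Coch W (Gl k V)}
    (hρ : ρ ∈ SHom k W (Gl k V) p) (hρ' : ρ' ∈ SHom k W (Gl k V) q) :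
    convRaw p q ρ ρ' ∈ SHom k W (Gl k V) r := by
  obtain ⟨f0, -, fs⟩ := hρ
  obtain ⟨g0, -, gs⟩ := hρ'
  refine ⟨?_, fun l j hj => ?_, IsSym.unshuffleSum (fun v => ?_) (fun u => ?_)⟩
  · simp only [convRaw, unshuffleSum_nil, f0, Pi.zero_apply]
    have := congrArg (fun φ => φ (ρ' [] (deg ([] : List (H W)) + q)))
      ((glMulₗ (k := k) (V := V) (deg ([] : List (H W)) + p) (deg ([] : List (H W)) + q)).map_zero)
    simp only [glMulₗ, LinearMap.mk₂_apply, LinearMap.zero_apply] at this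
    rw [this, smul_zero]
  · rw [convRaw, unshuffleSum_apply]
    refine unshuffleSum_eq_zero _ _ (fun u v huv => ?_)
    rw [Pi.smul_apply, Pi.single_eq_of_ne (by omega), smul_zero]
  · exact (fs.comp_deg p (fun a =>
      (glMulₗ a (deg v + q)).flip (ρ' v (deg v + q)) ∘ₗ LinearMap.proj a)).sign_smul q
  · exact (gs.comp_deg q (fun b =>
      glMulₗ (deg u + p) b (ρ u (deg u + p)) ∘ₗ LinearMap.proj b)).units_smul _

end gl

/-! ### The graded Lie algebras `𝓛_HLR(𝔤, V)` and `Der⁰ Ŝ(𝔤 ⊕ V)^*[-1]` -/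

/-- Apply a degree zero map to a homogeneous element. -/
def mapH {W W' : ℤ → Type*} (φ : (i : ℤ) → W i → W' i) (a : H W) : H W' := ⟨a.1, φ a.1 a.2⟩

theorem deg_map_mapH {W W' : ℤ → Type*} (φ : (i : ℤ) → W i → W' i) (l : List (H W)) :
    deg (l.map (mapH φ)) = deg l := by
  induction l with
  | nil => rfl
  | cons a l ih => simp [ih, mapH]

theorem IsSym.comp_mapH {k : Type*} [Field k] {W W' : ℤ → Type*} [∀ i, AddCommGroup (W i)]
    [∀ i, Module k (W i)] [∀ i, AddCommGroup (W' i)] [∀ i, Module k (W' i)]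
    {M : Type*} [AddCommGroup M] [Module k M] {F : List (H W') → M} (hF : IsSym k F)
    (φ : (i : ℤ) → W i →ₗ[k] W' i) :
    IsSym k (fun l : List (H W) => F (l.map (mapH (fun i => φ i)))) where
  add l₁ l₂ i x y := by
    simp only [List.map_append, List.map_cons, mapH, map_add]
    exact hF.add _ _ _ _ _
  smul l₁ l₂ i c x := by
    simp only [List.map_append, List.map_cons, mapH, map_smul]
    exact hF.smul _ _ _ _ _
  swap l₁ l₂ a b := by
    simp only [List.map_append, List.map_cons]
    exact hF.swap _ _ _ _

/-- The family with only a component in one argument, given by `φ`. -/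
def onSingle {W : ℤ → Type*} {M : Type*} [Zero M] (φ : (i : ℤ) → W i → M) : List (H W) → M
  | [b] => φ b.1 b.2
  | _ => 0

theorem isSym_onSingle {k : Type*} [Field k] {W : ℤ → Type*} [∀ i, AddCommGroup (W i)]
    [∀ i, Module k (W i)] {M : Type*} [AddCommGroup M] [Module k M]
    (φ : (i : ℤ) → W i →ₗ[k] M) : IsSym k (onSingle fun i => φ i) where
  add l₁ l₂ i x y := by
    rcases l₁ with _ | ⟨a, _ | ⟨b, l₁⟩⟩ <;> rcases l₂ with _ | ⟨c, l₂⟩ <;> simp [onSingle]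
  smul l₁ l₂ i c x := by
    rcases l₁ with _ | ⟨a, _ | ⟨b, l₁⟩⟩ <;> rcases l₂ with _ | ⟨c, l₂⟩ <;> simp [onSingle]
  swap l₁ l₂ a b := by
    rcases l₁ with _ | ⟨a, _ | ⟨b, l₁⟩⟩ <;> simp [onSingle]

section main

variable (k : Type*) [Field k] (g V : ℤ → Type*) [∀ i, AddCommGroup (g i)]
  [∀ i, Module k (g i)] [∀ i, AddCommGroup (V i)] [∀ i, Module k (V i)]

/-- `(𝔤 ⊕ V)[1]`. -/
abbrev Tot : ℤ → Type _ := fun i => g (i + 1) × V (i + 1)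

/-- The degree `p` part of `L = Der⁰ Ŝ(𝔤 ⊕ V)^*[-1]`, a graded Lie algebra under `bracket`. -/
abbrev L (p : ℤ) : Type _ := SHom k (Tot g V) (Tot g V) p

/-- The degree `p` part of the abelian subalgebra `𝔥 = Hom (𝔤^*[-1], Ŝ_{≥1} V^*[-1])`. -/
abbrev Ab (p : ℤ) : Type _ := SHom k (Shift V 1) (Shift g 1) p

/-- The degree `p` part of
`𝓛_HLR(𝔤, V) = Der⁰ Ŝ 𝔤^*[-1] ⋉ (Ŝ_{≥1} 𝔤^*[-1] ⊗ 𝔤𝔩(V))`. -/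
abbrev HLR (p : ℤ) : Type _ := SHom k (Shift g 1) (Shift g 1) p × SHom k (Shift g 1) (Gl k V) p

variable {k g V}

/-- The action of the derivation `m` on `ρ`. (The derivation `m` acts on the algebra
`Ŝ 𝔤^*[-1]` by minus the transpose of the family representing it, see `bracket`.) -/
def act {p q r : ℤ} (h : p + q = r) (m : SHom k (Shift g 1) (Shift g 1) p)
    (ρ : SHom k (Shift g 1) (Gl k V) q) : SHom k (Shift g 1) (Gl k V) r :=
  ⟨-(Int.negOnePow (p * q) • ins p ρ.1 m.1),
    neg_mem (units_smul_mem _ _ (ins_mem (by rw [add_comm]; exact h) ρ.2 m.2))⟩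

/-- The bracket of `Ŝ_{≥1} 𝔤^*[-1] ⊗ 𝔤𝔩(V)`. -/
def convBracket {p q r : ℤ} (h : p + q = r) (ρ : SHom k (Shift g 1) (Gl k V) p)
    (ρ' : SHom k (Shift g 1) (Gl k V) q) : SHom k (Shift g 1) (Gl k V) r :=
  ⟨convRaw p q ρ.1 ρ'.1 - Int.negOnePow (p * q) • convRaw q p ρ'.1 ρ.1,
    sub_mem (convRaw_mem h ρ.2 ρ'.2)
      (units_smul_mem _ _ (convRaw_mem (by rw [add_comm]; exact h) ρ'.2 ρ.2))⟩

/-- The semidirect product bracket of `𝓛_HLR(𝔤, V)`: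
`[(m, ρ), (m', ρ')] = ([m, m'], m · ρ' - (-1)^{pq} m' · ρ + [ρ, ρ'])`. -/
def hlrBracket {p q r : ℤ} (h : p + q = r) (Q : HLR k g V p) (Q' : HLR k g V q) :
    HLR k g V r :=
  (bracket h Q.1 Q'.1,
    act h Q.1 Q'.2 - Int.negOnePow (p * q) • act (by rw [add_comm]; exact h) Q'.1 Q.2 +
      convBracket h Q.2 Q'.2)

/-- The component in `V[1]` of the inclusion of `ρ` into `L`: the family
`(x₁, …, xₙ, v) ↦ ρ(x₁, …, xₙ)(v)`, extended by graded symmetry and by zero. -/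
def inclV (p : ℤ) (ρ : Coch (Shift g 1) (Gl k V)) : Coch (Tot g V) (Shift V 1) :=
  unshuffleSum (fun u => onSingle fun i x j =>
    (ρ (u.map (mapH fun _ => Prod.fst)) (deg u + p)).1 (i + 1) (j + 1) x.2)

theorem inclV_mem {p : ℤ} {ρ : Coch (Shift g 1) (Gl k V)}
    (hρ : ρ ∈ SHom k (Shift g 1) (Gl k V) p) :
    inclV p ρ ∈ SHom k (Tot g V) (Shift V 1) p := by
  obtain ⟨r0, rh, rs⟩ := hρ
  refine ⟨?_, fun l j hj => ?_, IsSym.unshuffleSum (fun v => ?_) (fun u => ?_)⟩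
  · simp [inclV, onSingle]
  · rw [inclV, unshuffleSum_apply]
    refine unshuffleSum_eq_zero _ _ (fun u v huv => ?_)
    rcases v with _ | ⟨b, _ | ⟨c, v⟩⟩
    · rfl
    · simp only [deg_cons, deg_nil] at huv
      change ((ρ _ (deg u + p)).1 (b.1 + 1) (j + 1)) b.2.2 = 0
      rw [(ρ _ (deg u + p)).2 _ _ (by omega)]
      rfl
    · rfl
  · rcases v with _ | ⟨b, _ | ⟨c, v⟩⟩
    · exact ⟨by simp [onSingle], by simp [onSingle], by simp [onSingle]⟩
    · have hs := rs.comp_mapH (W := Tot g V) (fun _ => LinearMap.fst k _ _)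
      exact hs.comp_deg p (fun d => (LinearMap.pi fun j =>
        LinearMap.applyₗ (R := k) b.2.2 ∘ₗ LinearMap.proj (j + 1) ∘ₗ
          LinearMap.proj (b.1 + 1) ∘ₗ (gl k V d).subtype ∘ₗ LinearMap.proj d))
    · exact ⟨by simp [onSingle], by simp [onSingle], by simp [onSingle]⟩
  · exact isSym_onSingle (W := Tot g V) (M := (j : ℤ) → V (j + 1))
      (fun i => LinearMap.pi (fun j => ((ρ (u.map (mapH fun _ => Prod.fst)) (deg u + p)).1
        (i + 1) (j + 1)) ∘ₗ LinearMap.snd k (g (i + 1)) (V (i + 1))))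

/-- The inclusion of `𝓛_HLR(𝔤, V)` into `L`. -/
def incl {p : ℤ} (Q : HLR k g V p) : L k g V p :=
  ⟨fun l j => (Q.1.1 (l.map (mapH fun _ => Prod.fst)) j, inclV p Q.2.1 l j), by
    obtain ⟨m0, mh, ms⟩ := Q.1.2
    obtain ⟨r0, rh, rs⟩ := inclV_mem Q.2.2
    have hs := ms.comp_mapH (W := Tot g V) (fun _ => LinearMap.fst k _ _)
    refine ⟨?_, fun l j h => ?_, ⟨fun l₁ l₂ i x y => ?_, fun l₁ l₂ i c x => ?_,
      fun l₁ l₂ a b => ?_⟩⟩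
    · funext j
      exact Prod.ext (congrFun m0 j) (congrFun r0 j)
    · exact Prod.ext (mh _ _ (by rwa [deg_map_mapH])) (rh _ _ h)
    · funext j
      exact Prod.ext (congrFun (hs.add l₁ l₂ i x y) j) (congrFun (rs.add l₁ l₂ i x y) j)
    · funext j
      exact Prod.ext (congrFun (hs.smul l₁ l₂ i c x) j) (congrFun (rs.smul l₁ l₂ i c x) j)
    · funext j
      exact Prod.ext (congrFun (hs.swap l₁ l₂ a b) j) (congrFun (rs.swap l₁ l₂ a b) j)⟩

/-- The inclusion of `𝔥` into `L`. -/
def inclAb {p : ℤ} (T : Ab k g V p) : L k g V p :=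
  ⟨fun l j => (T.1 (l.map (mapH fun _ => Prod.snd)) j, 0), by
    obtain ⟨t0, th, ts⟩ := T.2
    have hs := ts.comp_mapH (W := Tot g V) (fun _ => LinearMap.snd k _ _)
    refine ⟨?_, fun l j h => ?_, hs.linearMap
      (LinearMap.pi fun j => LinearMap.inl k (g (j + 1)) (V (j + 1)) ∘ₗ LinearMap.proj j)⟩
    · funext j
      exact Prod.ext (congrFun t0 j) rfl
    · exact Prod.ext (th _ _ (by rwa [deg_map_mapH])) rfl⟩

/-- The projection of `L` onto `𝔥`: take the part in which all arguments are in `V[1]` and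
the value is in `𝔤[1]`. -/
def projAb {p : ℤ} (f : L k g V p) : Ab k g V p :=
  ⟨fun l j => (f.1 (l.map (mapH fun _ v => (0, v))) j).1, by
    obtain ⟨f0, fh, fs⟩ := f.2
    have hs := fs.comp_mapH (W := Shift V 1)
      (fun i => LinearMap.inr k (g (i + 1)) (V (i + 1)))
    refine ⟨?_, fun l j h => ?_, hs.linearMap
      (LinearMap.pi fun j => LinearMap.fst k (g (j + 1)) (V (j + 1)) ∘ₗ LinearMap.proj j)⟩
    · funext j
      exact congrArg Prod.fst (congrFun f0 j)
    · exact congrArg Prod.fst (fh _ j (by rwa [deg_map_mapH]))⟩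

/-- The right adjoint action of `T ∈ 𝔥⁰` on `L`. -/
def ad (T : Ab k g V 0) {p : ℤ} (f : L k g V p) : L k g V p :=
  bracket (add_zero p) f (inclAb T)

/-- The iterated bracket `[⋯[[Q, θ₁], θ₂]⋯, θ_s]`, together with its degree. -/
def nested (Q : H fun p => L k g V p) (θ : List (H fun p => Ab k g V p)) :
    H fun p => L k g V p :=
  θ.foldl (fun a t => ⟨a.1 + t.1, bracket rfl a.2 (inclAb t.2)⟩) Q

variable (k g V)

/-- The graded vector space `(𝓛_HLR(𝔤, V) ⊕ 𝔥[-1])[1] = 𝓛_HLR(𝔤, V)[1] ⊕ 𝔥`. -/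
abbrev HRB1 : ℤ → Type _ := fun d => HLR k g V (d + 1) × Ab k g V d

/-- The structure maps of the `L∞`-algebra `𝓛_HLR(𝔤, V) ⊕ 𝔥[-1]`: the graded symmetric
multilinear maps determined by
`m₂ (Q[1], Q'[1]) = (-1)^{|Q|} [Q, Q'][1]` and
`m_s (Q[1], θ₁, …, θ_{s-1}) = P [⋯[Q, θ₁], ⋯, θ_{s-1}]` for `s ≥ 1` (for `s = 1` this is
`P Q = 0`), and by the vanishing on all combinations of arguments that are not permutations of these. -/
def hrbProducts : Coch (HRB1 k g V) (HRB1 k g V) := fun l =>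
  (match l with
    | [a, b] => Pi.single (M := HRB1 k g V) (a.1 + b.1 + 1)
        (Int.negOnePow (a.1 + 1) • hlrBracket (by ring) a.2.1 b.2.1, 0)
    | _ => 0) +
  unshuffleSum (fun u v => onSingle (fun d a =>
    let f := nested ⟨d + 1, incl a.1⟩ (v.map (mapH fun _ => Prod.snd))
    Pi.single (M := HRB1 k g V) f.1 (0, projAb f.2)) u) l

/-- The order filtration of `𝓛_HLR(𝔤, V)[1] ⊕ 𝔥`. -/
def hrbFiltration (d : ℤ) (n : ℕ) : Submodule k (HRB1 k g V d) :=
  ((orderFiltration k (Shift g 1) (Shift g 1) (d + 1) n).prod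
    (orderFiltration k (Shift g 1) (Gl k V) (d + 1) n)).prod
      (orderFiltration k (Shift V 1) (Shift g 1) d n)

variable {k g V}

/-- A degree `1` element of `Ŝ_{≥1} W^* ⊗ 𝔤𝔩(V)` as a family of maps `Sⁿ W → 𝔤𝔩(V)[1]` of
degree `0`. -/
def desuspend {W : ℤ → Type*} [∀ i, AddCommGroup (W i)] [∀ i, Module k (W i)]
    (ρ : SHom k W (Gl k V) 1) : SHom k W (Shift (Gl k V) 1) 0 :=
  ⟨fun l j => ρ.1 l (j + 1), by
    obtain ⟨r0, rh, rs⟩ := ρ.2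
    refine ⟨?_, fun l j h => rh _ _ (by omega), rs.linearMap
      (LinearMap.pi fun j => LinearMap.proj (R := k) (φ := Gl k V) (j + 1))⟩
    funext j
    exact congrFun r0 (j + 1)⟩

/-- `ρ` is a representation of the `L∞`-algebra `(𝔤, m)` in `V`, i.e. an `L∞`-map from `𝔤` to
`𝔤𝔩(V)`. -/
def IsRepresentation (m : SHom k (Shift g 1) (Shift g 1) 1)
    (ρ : SHom k (Shift g 1) (Gl k V) 1) : Prop :=
  IsLInfinityMap m.1 (glProducts k V) (desuspend ρ)

/-- `E = e^{ad_T}(f) = ∑_{n ≥ 0} (1/n!) ad_T^n (f)`. -/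
def IsExpAd (T : Ab k g V 0) {p : ℤ} (f E : L k g V p) : Prop :=
  ConvergesTo (orderFiltration k (Tot g V) (Tot g V) p)
    (fun r => ∑ n ∈ Finset.range r, ((n.factorial : k)⁻¹) • (ad T)^[n] f) E

/-- `T` is a homotopy relative Rota-Baxter operator: `P (e^{ad_T}(m + ρ)) = 0`. -/
def IsHomotopyRelativeRBOperator (m : SHom k (Shift g 1) (Shift g 1) 1)
    (ρ : SHom k (Shift g 1) (Gl k V) 1) (T : Ab k g V 0) : Prop :=
  ∃ E : L k g V 1, IsExpAd T (incl (m, ρ)) E ∧ projAb E = 0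

/-- `(m, ρ, T)` is a homotopy relative Rota-Baxter Lie algebra on `𝔤` and `V`. -/
structure IsHomotopyRelativeRBLieAlgebra (m : SHom k (Shift g 1) (Shift g 1) 1)
    (ρ : SHom k (Shift g 1) (Gl k V) 1) (T : Ab k g V 0) : Prop where
  isLInfinity : IsLInfinity m
  isRepresentation : IsRepresentation m ρ
  isOperator : IsHomotopyRelativeRBOperator m ρ T

end main

end HRB

/-!
The Maurer-Cartan series of `((m, ρ), T)` can be computed explicitly. As all entries have degree
`0`, no Koszul signs occur: the product of `n + 1` equal arguments `(Φ, T)` with `Φ = (m, ρ)` takes `Φ`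
from one position and `T` from the others, which gives `n + 1` times `P (ad_T^n Φ)`, and the binary
product has the additional term `-[Φ, Φ]`. The partial sums are therefore
`(-½ [Φ, Φ], P (∑ (1/n!) ad_T^n Φ))` (`mcSum_hrbProducts`), so the Maurer-Cartan equation says that
`[Φ, Φ] = 0` and that the projected exponential series converges to `0` (`isMC_iff`).

The components of `[Φ, Φ]` are `2 (m ∘ m)` and `2 (ρ ∘ m + ρ ρ)` (`hlrBracket_self_eq_zero_iff`).
The vanishing of the second one is the definition of a representation: `𝔤𝔩(V)` has only a binary
product, so the right hand side of the equation of an `L∞`-map reduces to the sum over unshuffles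
into two blocks, whose two commutator terms agree after exchanging the blocks
(`isRepresentation_iff`).

The condition on `T` asks in addition for the existence of `e^{ad_T} Φ` in `L`, before projecting.
This is automatic (`exists_isExpAd`). The operator `ad_T` need not raise the number of arguments,
but it raises by at least one the number of arguments from `V`, increased by one if the output is
in `𝔤` (`VOrderGE.ad`), which bounds the number of nonzero terms on each list of arguments.
-/

namespace HRB

/-! ### Sums over unshuffles -/

section Unshuffle

variable {W : ℤ → Type*} {M : Type*} [AddCommGroup M]

theorem unshuffleSum_congr {F G : List (H W) → List (H W) → M} {l : List (H W)}
    (h : ∀ t ∈ splits l, F t.2.1 t.2.2 = G t.2.1 t.2.2) :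
    unshuffleSum F l = unshuffleSum G l := by
  unfold unshuffleSum
  congr 1
  exact List.map_congr_left fun t ht => by rw [h t ht]

theorem map_unshuffleSum {N : Type*} [AddCommGroup N] (φ : M →+ N)
    (F : List (H W) → List (H W) → M) (l : List (H W)) :
    φ (unshuffleSum F l) = unshuffleSum (fun u v => φ (F u v)) l := by
  simp only [unshuffleSum, map_list_sum, List.map_map, Function.comp_def, Units.smul_def, map_zsmul]

theorem unshuffleSum_eq_zero_of_mem {F : List (H W) → List (H W) → M} {l : List (H W)}
    (h : ∀ t ∈ splits l, F t.2.1 t.2.2 = 0) : unshuffleSum F l = 0 := by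
  rw [unshuffleSum_congr (G := fun _ _ => 0) h, unshuffleSum_eq_zero _ _ fun _ _ _ => rfl]

theorem neg_one_units_smul (x : M) : (-1 : ℤˣ) • x = -x := by
  rw [Units.neg_smul, one_smul]

theorem perm_of_mem_splits {l : List (H W)} {t : ℤˣ × List (H W) × List (H W)}
    (ht : t ∈ splits l) : (t.2.1 ++ t.2.2).Perm l := by
  induction l generalizing t with
  | nil => simp [splits] at ht; subst ht; simp
  | cons a l ih =>
    simp only [splits, List.mem_append, List.mem_map] at ht
    rcases ht with ⟨t', h, rfl⟩ | ⟨t', h, rfl⟩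
    · exact (ih h).cons a
    · exact List.perm_middle.trans ((ih h).cons a)

/-- Exchanging the two halves of an unshuffle multiplies its Koszul sign by
`(-1)^{|x_S| |x_{Sᶜ}|}`. -/
theorem unshuffleSum_comm (F : List (H W) → List (H W) → M) (l : List (H W)) :
    unshuffleSum F l =
      unshuffleSum (fun u v => Int.negOnePow (deg u * deg v) • F v u) l := by
  induction l generalizing F with
  | nil => simp
  | cons a l ih =>
    rw [unshuffleSum_cons, unshuffleSum_cons, ih, ih (fun u v => _ • F u (a :: v)), add_comm]
    congr 1
    · congr 1
      funext u v
      rw [smul_smul, ← Int.negOnePow_add, deg_cons]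
      congr 2
      ring
    · congr 1
      funext u v
      rw [smul_smul, ← Int.negOnePow_add, deg_cons]
      congr 1
      rw [Int.negOnePow_eq_iff]
      exact ⟨-(a.1 * deg u), by ring⟩

theorem unshuffleSum_of_left_eq_nil (F : List (H W) → List (H W) → M)
    (hF : ∀ u v, u ≠ [] → F u v = 0) (l : List (H W)) : unshuffleSum F l = F [] l := by
  induction l generalizing F with
  | nil => simp
  | cons a l ih =>
    rw [unshuffleSum_cons, unshuffleSum_eq_zero _ _ fun u v _ => hF _ v (by simp), zero_add,
      ih (fun u v => _ • F u (a :: v)) fun u v hu => by rw [hF u _ hu, smul_zero]]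
    simp

theorem unshuffleSum_of_right_eq_nil (F : List (H W) → List (H W) → M)
    (hF : ∀ u v, v ≠ [] → F u v = 0) (l : List (H W)) : unshuffleSum F l = F l [] := by
  rw [unshuffleSum_comm, unshuffleSum_of_left_eq_nil]
  · simp
  · intro u v hu
    rw [hF v u hu, smul_zero]

/-- Evaluated on equal arguments of degree `0`, each of the `n + 1` unshuffles with a single
element in the first half contributes the same term. -/
theorem unshuffleSum_onSingle_replicate (G : List (H W) → (d : ℤ) → W d → M) (x : W 0) (n : ℕ) :
    unshuffleSum (fun u v => onSingle (G v) u) (List.replicate (n + 1) ⟨0, x⟩) =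
      (n + 1) • G (List.replicate n ⟨0, x⟩) 0 x := by
  induction n generalizing G with
  | zero => simp [unshuffleSum_cons, onSingle]
  | succ n ih =>
    rw [List.replicate_succ, unshuffleSum_cons, unshuffleSum_of_left_eq_nil]
    · simp only [zero_mul, Int.negOnePow_zero, one_smul]
      rw [ih fun v => G (⟨0, x⟩ :: v), ← List.replicate_succ, add_comm, succ_nsmul _ (n + 1)]
      rfl
    · rintro (_ | ⟨b, u⟩) v hu
      · exact absurd rfl hu
      · rfl

end Unshuffle

/-! ### The order filtration -/

theorem smul_neg_mem_iff {k M : Type*} [Field k] [AddCommGroup M] [Module k M]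
    (N : Submodule k M) {c : k} (hc : c ≠ 0) (x : M) : c • -x ∈ N ↔ x ∈ N :=
  (N.smul_mem_iff hc).trans N.neg_mem_iff

section Filtration

variable {k : Type*} [Field k] {W W' : ℤ → Type*} [∀ i, AddCommGroup (W i)]
  [∀ i, Module k (W i)] [∀ i, AddCommGroup (W' i)] [∀ i, Module k (W' i)]

/-- The order filtration is separated. -/
theorem eq_zero_of_forall_mem_orderFiltration {p : ℤ} {f : SHom k W W' p}
    (h : ∀ n, f ∈ orderFiltration k W W' p n) : f = 0 :=
  Subtype.ext (funext fun l => h (l.length + 1) l (Nat.lt_succ_self _))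

/-- The order filtration is complete, for sequences whose values on lists of length `n` are
constant from an index depending only on `n` onwards. -/
theorem exists_convergesTo_orderFiltration {p : ℤ} (s : ℕ → SHom k W W' p) (c : ℕ)
    (hs : ∀ (l : List (H W)) (r : ℕ), l.length + c ≤ r → (s r).1 l = (s (l.length + c)).1 l) :
    ∃ E, ConvergesTo (orderFiltration k W W' p) s E := by
  refine ⟨⟨fun l => (s (l.length + c)).1 l, ?_, fun l j hj => (s _).2.2.1 l j hj,
    fun l₁ l₂ i x y => ?_, fun l₁ l₂ i a x => ?_, fun l₁ l₂ a b => ?_⟩, fun n => ⟨n + c, ?_⟩⟩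
  · exact (s _).2.1
  · simpa using (s _).2.2.2.add l₁ l₂ i x y
  · simpa using (s _).2.2.2.smul l₁ l₂ i a x
  · simpa using (s _).2.2.2.swap l₁ l₂ a b
  · intro r hr l hl
    change (s r).1 l - (s (l.length + c)).1 l = 0
    rw [hs l r (by omega), sub_self]

/-- The partial sums of the Maurer-Cartan series. -/
def mcSum (μ : Coch W W) (ξ : W 0) (r : ℕ) : W 1 :=
  ∑ i ∈ Finset.Icc 1 r, ((i.factorial : k)⁻¹) • μ (List.replicate i ⟨0, ξ⟩) 1

theorem isMC_iff_mcSum (F : (j : ℤ) → ℕ → Submodule k (W j)) (μ : Coch W W) (ξ : W 0) :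
    IsMC F μ ξ ↔ ∀ n, ∃ N, ∀ r ≥ N, mcSum (k := k) μ ξ r ∈ F 1 n := by
  simp only [IsMC, ConvergesTo, sub_zero, mcSum]

end Filtration

/-! ### Convergence of the exponential series -/

section CountV

variable {g V : ℤ → Type*} [∀ i, AddCommGroup (V i)]

open scoped Classical in
/-- The number of arguments with nonzero component in `V[1]`. -/
noncomputable def countV (l : List (H (Tot g V))) : ℕ :=
  l.countP fun a => decide (a.2.2 ≠ 0)

@[simp] theorem countV_cons_zero (i : ℤ) (x : g (i + 1)) (l : List (H (Tot g V))) :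
    countV (⟨i, (x, 0)⟩ :: l) = countV l := by
  simp [countV]

theorem countV_le_length (l : List (H (Tot g V))) : countV l ≤ l.length :=
  List.countP_le_length

theorem countV_of_mem_splits {l : List (H (Tot g V))}
    {t : ℤˣ × List (H (Tot g V)) × List (H (Tot g V))} (ht : t ∈ splits l) :
    countV t.2.1 + countV t.2.2 = countV l := by
  rw [countV, countV, countV, ← List.countP_append]
  exact (perm_of_mem_splits ht).countP_eq _

end CountV

section Main

variable {k : Type*} [Field k] {g V : ℤ → Type*} [∀ i, AddCommGroup (g i)]
  [∀ i, Module k (g i)] [∀ i, AddCommGroup (V i)] [∀ i, Module k (V i)]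

theorem inclAb_apply_cons_of_snd_eq_zero {p : ℤ} (T : Ab k g V p) (a : H (Tot g V))
    (l : List (H (Tot g V))) (ha : a.2.2 = 0) : (inclAb T).1 (a :: l) = 0 := by
  funext j
  refine Prod.ext ?_ rfl
  obtain ⟨i, x, v⟩ := a
  obtain rfl : v = 0 := ha
  exact congrFun (T.2.2.2.zero_arg [] _ i) j

theorem inclAb_apply_of_countV_eq_zero {p : ℤ} (T : Ab k g V p) (l : List (H (Tot g V)))
    (hl : countV l = 0) : (inclAb T).1 l = 0 := by
  rcases l with _ | ⟨a, l⟩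
  · exact (inclAb T).2.1
  · refine inclAb_apply_cons_of_snd_eq_zero T a l ?_
    by_contra ha
    simp [countV, ha] at hl

/-- Every nonzero component of `f` has at least `n - 1` inputs in `V[1]` if its output is in
`𝔤[1]`, and at least `n` if its output is in `V[1]`. -/
def VOrderGE (n : ℕ) (f : Coch (Tot g V) (Tot g V)) : Prop :=
  ∀ l j, (countV l + 1 < n → (f l j).1 = 0) ∧ (countV l < n → (f l j).2 = 0)

/-- An operator `T` has outputs in `𝔤[1]` and at least one input, all inputs being in `V[1]`.
Inserting `T` into `f` thus trades an input in `𝔤[1]` for at least one in `V[1]`, and inserting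
`f` into `T` requires the output of `f` to be in `V[1]` and turns it into one in `𝔤[1]`. -/
theorem VOrderGE.ad {p : ℤ} {n : ℕ} {f : L k g V p} (hf : VOrderGE n f.1) (T : Ab k g V 0) :
    VOrderGE (n + 1) (ad T f).1 := by
  have h₁ : ∀ l j, (countV l + 1 < n + 1 → (ins 0 f.1 (inclAb T).1 l j).1 = 0) ∧
      (countV l < n + 1 → (ins 0 f.1 (inclAb T).1 l j).2 = 0) := by
    intro l j
    -- A term is zero unless `T` takes some `V[1]`-input of `l`, which its output does not replace.
    have hT : ∀ t ∈ splits l, f.1 (⟨deg t.2.1 + 0, (inclAb T).1 t.2.1 (deg t.2.1 + 0)⟩ :: t.2.2) j =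
        0 ∨ countV (⟨deg t.2.1 + 0, (inclAb T).1 t.2.1 (deg t.2.1 + 0)⟩ :: t.2.2) + 1 ≤
          countV l := by
      intro t ht
      have hc := countV_of_mem_splits ht
      have hv : countV (⟨deg t.2.1 + 0, (inclAb T).1 t.2.1 (deg t.2.1 + 0)⟩ :: t.2.2) =
        countV t.2.2 := countV_cons_zero _ _ _
      by_cases h0 : countV t.2.1 = 0
      · left
        rw [inclAb_apply_of_countV_eq_zero T _ h0]
        exact congrFun (f.2.2.2.zero_arg [] _ _) j
      · right
        omega
    rw [ins, unshuffleSum_apply]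
    constructor
    · intro hl
      refine (map_unshuffleSum (AddMonoidHom.fst (g (j + 1)) (V (j + 1))) _ _).trans
        (unshuffleSum_eq_zero_of_mem fun t ht => ?_)
      rcases hT t ht with h | h
      · exact congrArg Prod.fst h
      · exact (hf _ j).1 (by omega)
    · intro hl
      refine (map_unshuffleSum (AddMonoidHom.snd (g (j + 1)) (V (j + 1))) _ _).trans
        (unshuffleSum_eq_zero_of_mem fun t ht => ?_)
      rcases hT t ht with h | h
      · exact congrArg Prod.snd h
      · exact (hf _ j).2 (by omega)
  have h₂ : ∀ l j, (countV l + 1 < n + 1 → (ins p (inclAb T).1 f.1 l j).1 = 0) ∧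
      (ins p (inclAb T).1 f.1 l j).2 = 0 := by
    intro l j
    rw [ins]
    constructor
    · intro hl
      rw [unshuffleSum_eq_zero_of_mem]
      · rfl
      · intro t ht
        have hc := countV_of_mem_splits ht
        exact inclAb_apply_cons_of_snd_eq_zero T _ _ ((hf _ _).2 (by omega))
    · rw [unshuffleSum_apply]
      exact (map_unshuffleSum (AddMonoidHom.snd (g (j + 1)) (V (j + 1))) _ _).trans
        (unshuffleSum_eq_zero_of_mem fun t ht => rfl)
  intro l j
  change (_ → (ins 0 f.1 (inclAb T).1 l j - Int.negOnePow (p * 0) • ins p (inclAb T).1 f.1 l j).1 =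
    0) ∧ (_ → (ins 0 f.1 (inclAb T).1 l j - Int.negOnePow (p * 0) •
      ins p (inclAb T).1 f.1 l j).2 = 0)
  rw [mul_zero, Int.negOnePow_zero, one_smul, Prod.fst_sub, Prod.snd_sub]
  exact ⟨fun hl => by rw [(h₁ l j).1 hl, (h₂ l j).1 hl, sub_zero],
    fun hl => by rw [(h₁ l j).2 hl, (h₂ l j).2, sub_zero]⟩

theorem vOrderGE_iterate_ad {p : ℤ} (f : L k g V p) (T : Ab k g V 0) (n : ℕ) :
    VOrderGE n ((HRB.ad T)^[n] f).1 := by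
  induction n with
  | zero =>
    exact fun l j => ⟨fun h => absurd h (Nat.not_lt_zero _), fun h => absurd h (Nat.not_lt_zero _)⟩
  | succ n ih =>
    rw [Function.iterate_succ_apply']
    exact ih.ad T

/-- The partial sums of `e^{ad_T}(f)`. -/
def expAdSum (T : Ab k g V 0) {p : ℤ} (f : L k g V p) (r : ℕ) : L k g V p :=
  ∑ n ∈ Finset.range r, ((n.factorial : k)⁻¹) • (ad T)^[n] f

theorem expAdSum_apply (T : Ab k g V 0) {p : ℤ} (f : L k g V p) (r : ℕ)
    (l : List (H (Tot g V))) : (expAdSum T f r).1 l =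
      ∑ n ∈ Finset.range r, ((n.factorial : k)⁻¹) • ((ad T)^[n] f).1 l := by
  simp [expAdSum, Finset.sum_apply]

/-- The exponential series converges for every `f`, although `ad_T` need not increase the number of
arguments: on `l.length` arguments the terms with `n ≥ l.length + 2` vanish. -/
theorem exists_isExpAd (T : Ab k g V 0) {p : ℤ} (f : L k g V p) : ∃ E, IsExpAd T f E := by
  refine exists_convergesTo_orderFiltration (expAdSum T f) 2 fun l r hr => ?_
  rw [expAdSum_apply, expAdSum_apply]
  refine (Finset.sum_subset (Finset.range_subset_range.2 hr) fun n _ hn => ?_).symm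
  have hl := countV_le_length l
  rw [Finset.mem_range, not_lt] at hn
  have h := fun j => vOrderGE_iterate_ad f T n l j
  have : ((ad T)^[n] f).1 l = 0 :=
    funext fun j => Prod.ext ((h j).1 (by omega)) ((h j).2 (by omega))
  rw [this, smul_zero]

/-! ### The Maurer-Cartan series -/

/-- `projAb` as a linear map. -/
def projAbₗ (p : ℤ) : L k g V p →ₗ[k] Ab k g V p where
  toFun := projAb
  map_add' _ _ := rfl
  map_smul' _ _ := rfl

theorem projAb_mem_orderFiltration {p : ℤ} {n : ℕ} {f : L k g V p}
    (hf : f ∈ orderFiltration k (Tot g V) (Tot g V) p n) :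
    projAb f ∈ orderFiltration k (Shift V 1) (Shift g 1) p n := by
  intro l hl
  funext j
  exact congrArg Prod.fst (congrFun (hf _ (by simpa using hl)) j)

/-- Since the exponential series converges in `L`, the condition on `T` only concerns the series
of the projections to `𝔥`. -/
theorem isHomotopyRelativeRBOperator_iff (m : SHom k (Shift g 1) (Shift g 1) 1)
    (ρ : SHom k (Shift g 1) (Gl k V) 1) (T : Ab k g V 0) :
    IsHomotopyRelativeRBOperator m ρ T ↔
      ConvergesTo (orderFiltration k (Shift V 1) (Shift g 1) 1)
        (fun r => projAb (expAdSum T (incl (m, ρ)) r)) 0 := by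
  constructor
  · rintro ⟨E, hE, hPE⟩ n
    obtain ⟨N, hN⟩ := hE n
    refine ⟨N, fun r hr => ?_⟩
    rw [← hPE]
    exact projAb_mem_orderFiltration (hN r hr)
  · intro h
    obtain ⟨E, hE⟩ := exists_isExpAd T (incl (m, ρ))
    refine ⟨E, hE, eq_zero_of_forall_mem_orderFiltration fun n => ?_⟩
    obtain ⟨N, hN⟩ := hE n
    obtain ⟨N', hN'⟩ := h n
    have h₁ := projAb_mem_orderFiltration (hN (max N N') (le_max_left _ _))
    have h₂ := hN' (max N N') (le_max_right _ _)
    have := sub_mem h₂ h₁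
    rw [sub_zero] at this
    refine (congrArg (· ∈ _) ?_).mp this
    change projAbₗ 1 _ - projAbₗ 1 (_ - E) = projAbₗ 1 E
    rw [map_sub]
    exact sub_sub_cancel _ _

theorem sigma_bracket_eq {W : ℤ → Type*} [∀ i, AddCommGroup (W i)] [∀ i, Module k (W i)]
    {p q r r' : ℤ} (h : p + q = r) (h' : p + q = r') (f : SHom k W W p) (f' : SHom k W W q) :
    (⟨r, bracket h f f'⟩ : H fun p => SHom k W W p) = ⟨r', bracket h' f f'⟩ := by
  subst h h'
  rfl

theorem nested_replicate {p : ℤ} (f : L k g V p) (T : Ab k g V 0) (n : ℕ) :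
    nested ⟨p, f⟩ (List.replicate n ⟨0, T⟩) = ⟨p, (ad T)^[n] f⟩ := by
  induction n generalizing f with
  | zero => rfl
  | succ n ih =>
    rw [Function.iterate_succ_apply, ← ih (ad T f), List.replicate_succ]
    exact congrArg (fun Q => nested Q (List.replicate n ⟨0, T⟩))
      (sigma_bracket_eq rfl (add_zero p) f (inclAb T))

/-- Each of the `n + 1` positions of `Φ` among the arguments contributes `P (ad_T^n Φ)`; for two
arguments there is in addition the bracket of `Φ` with itself. -/
theorem hrbProducts_replicate (Φ : HLR k g V 1) (T : Ab k g V 0) (n : ℕ) :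
    hrbProducts k g V (List.replicate (n + 1) ⟨0, (Φ, T)⟩) 1 =
      (if n = 1 then -hlrBracket (r := 1 + 1) rfl Φ Φ else 0,
        (n + 1) • projAb ((ad T)^[n] (incl Φ))) := by
  have h : unshuffleSum (W := HRB1 k g V) (fun u v => onSingle (fun d a =>
      let f := nested ⟨d + 1, incl a.1⟩ (v.map (mapH fun _ => Prod.snd))
      Pi.single (M := HRB1 k g V) f.1 (0, projAb f.2)) u)
        (List.replicate (n + 1) ⟨0, (Φ, T)⟩) 1 = (0, (n + 1) • projAb ((ad T)^[n] (incl Φ))) := by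
    rw [unshuffleSum_onSingle_replicate (W := HRB1 k g V) (fun v d a =>
      let f := nested ⟨d + 1, incl a.1⟩ (v.map (mapH fun _ => Prod.snd))
      Pi.single (M := HRB1 k g V) f.1 (0, projAb f.2))]
    rw [List.map_replicate]
    have := nested_replicate (incl Φ) T n
    change (n + 1) • (let f := nested ⟨1, incl Φ⟩ (List.replicate n ⟨0, T⟩)
      Pi.single (M := HRB1 k g V) f.1 (0, projAb f.2) : (d : ℤ) → HRB1 k g V d) 1 = _
    rw [this]
    simp
  unfold hrbProducts
  rw [Pi.add_apply, h]
  rcases n with _ | _ | n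
  · simp
  · simp only [List.replicate]
    change Pi.single (M := HRB1 k g V) 1 (Int.negOnePow 1 • hlrBracket (r := 1 + 1) rfl Φ Φ, 0) 1 +
      _ = _
    rw [Pi.single_eq_same, Int.negOnePow_one, if_pos trivial]
    refine Prod.ext ((add_zero _).trans ?_) (zero_add _)
    exact Prod.ext (neg_one_units_smul (M := SHom k (Shift g 1) (Shift g 1) (1 + 1)) _)
      (neg_one_units_smul (M := SHom k (Shift g 1) (Gl k V) (1 + 1)) _)
  · simp [List.replicate]

/-- The factor `n + 1`, which counts the positions of `Φ` among the `n + 1` arguments of a term of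
the Maurer-Cartan series, turns its coefficient `1/(n+1)!` into the coefficient `1/n!` of the
exponential series. -/
theorem sum_inv_factorial_smul_prod [CharZero k] {A B : Type*} [AddCommGroup A] [Module k A]
    [AddCommGroup B] [Module k B] (b : A) (c : ℕ → B) (f : ℕ → A × B)
    (h : ∀ n, f (n + 1) = (if n = 1 then b else 0, (n + 1) • c n)) {r : ℕ} (hr : 2 ≤ r) :
    ∑ i ∈ Finset.Icc 1 r, ((i.factorial : k)⁻¹) • f i =
      ((2 : k)⁻¹ • b, ∑ n ∈ Finset.range r, ((n.factorial : k)⁻¹) • c n) := by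
  rw [← Finset.Ico_succ_right_eq_Icc, Order.succ_eq_add_one, Finset.sum_Ico_eq_sum_range,
    Nat.add_sub_cancel]
  simp only [add_comm 1, h]
  refine Prod.ext ?_ ?_
  · rw [Prod.fst_sum, Finset.sum_eq_single_of_mem 1 (Finset.mem_range.2 hr)]
    · simp
    · intro n _ hn
      simp [hn]
  · rw [Prod.snd_sum]
    refine Finset.sum_congr rfl fun n _ => ?_
    have hn' : ((n + 1 : ℕ) : k) ≠ 0 := Nat.cast_ne_zero.2 n.succ_ne_zero
    rw [Prod.smul_snd, ← Nat.cast_smul_eq_nsmul k, smul_smul, Nat.factorial_succ,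
      Nat.cast_mul, mul_inv_rev, mul_assoc, inv_mul_cancel₀ hn', mul_one]

theorem projAb_expAdSum (T : Ab k g V 0) {p : ℤ} (f : L k g V p) (r : ℕ) :
    projAb (expAdSum T f r) =
      ∑ n ∈ Finset.range r, ((n.factorial : k)⁻¹) • projAb ((ad T)^[n] f) := by
  change projAbₗ p _ = _
  rw [expAdSum, map_sum]
  exact Finset.sum_congr rfl fun n _ => map_smul _ _ _

theorem mcSum_hrbProducts [CharZero k] (Φ : HLR k g V 1) (T : Ab k g V 0) {r : ℕ} (hr : 2 ≤ r) :
    mcSum (k := k) (hrbProducts k g V) (Φ, T) r =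
      ((2 : k)⁻¹ • -hlrBracket (r := 1 + 1) rfl Φ Φ, projAb (expAdSum T (incl Φ) r)) := by
  rw [projAb_expAdSum]
  exact sum_inv_factorial_smul_prod (k := k) (A := HLR k g V (1 + 1)) (B := Ab k g V 1) _ _ _
    (hrbProducts_replicate Φ T) hr

/-- The two components of the Maurer-Cartan equation: from the second partial sum on, the component
in `𝓛_HLR(𝔤, V)[1]` is constantly `-½ [Φ, Φ]`. -/
theorem isMC_iff [CharZero k] (Φ : HLR k g V 1) (T : Ab k g V 0) :
    IsMC (hrbFiltration k g V) (hrbProducts k g V) (Φ, T) ↔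
      hlrBracket (r := 1 + 1) rfl Φ Φ = 0 ∧
        ConvergesTo (orderFiltration k (Shift V 1) (Shift g 1) 1)
          (fun r => projAb (expAdSum T (incl Φ) r)) 0 := by
  have h2 : (2 : k)⁻¹ ≠ 0 := inv_ne_zero two_ne_zero
  have hs : ∀ n r, 2 ≤ r → (mcSum (k := k) (hrbProducts k g V) (Φ, T) r ∈
        hrbFiltration k g V 1 n ↔
      ((hlrBracket (r := 1 + 1) rfl Φ Φ).1 ∈
          orderFiltration k (Shift g 1) (Shift g 1) (1 + 1) n ∧
        (hlrBracket (r := 1 + 1) rfl Φ Φ).2 ∈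
          orderFiltration k (Shift g 1) (Gl k V) (1 + 1) n) ∧
      projAb (expAdSum T (incl Φ) r) - 0 ∈ orderFiltration k (Shift V 1) (Shift g 1) 1 n) := by
    intro n r hr
    rw [sub_zero, mcSum_hrbProducts Φ T hr]
    refine and_congr_left' (and_congr ?_ ?_)
    · exact smul_neg_mem_iff _ h2 (hlrBracket rfl Φ Φ).1
    · exact smul_neg_mem_iff _ h2 (hlrBracket rfl Φ Φ).2
  rw [isMC_iff_mcSum]
  constructor
  · intro h
    refine ⟨Prod.ext (eq_zero_of_forall_mem_orderFiltration fun n => ?_)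
      (eq_zero_of_forall_mem_orderFiltration fun n => ?_), fun n => ?_⟩
    · obtain ⟨N, hN⟩ := h n
      exact ((hs n _ (le_max_left 2 N)).1 (hN _ (le_max_right 2 N))).1.1
    · obtain ⟨N, hN⟩ := h n
      exact ((hs n _ (le_max_left 2 N)).1 (hN _ (le_max_right 2 N))).1.2
    · obtain ⟨N, hN⟩ := h n
      exact ⟨max 2 N, fun r hr => ((hs n r (by omega)).1 (hN r (by omega))).2⟩
  · rintro ⟨h₁, h₂⟩ n
    obtain ⟨N, hN⟩ := h₂ n
    refine ⟨max 2 N, fun r hr => (hs n r (by omega)).2 ⟨⟨?_, ?_⟩, hN r (by omega)⟩⟩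
    · rw [h₁]; exact zero_mem _
    · rw [h₁]; exact zero_mem _

/-! ### The bracket of the semidirect product -/

/-- The components of `½ [(m, ρ), (m, ρ)]` are `m ∘ m` and `ρ ∘ m + ρ ρ`. -/
theorem hlrBracket_self_eq_zero_iff [CharZero k] (m : SHom k (Shift g 1) (Shift g 1) 1)
    (ρ : SHom k (Shift g 1) (Gl k V) 1) :
    hlrBracket (r := 1 + 1) rfl (m, ρ) (m, ρ) = 0 ↔
      IsLInfinity m ∧ ∀ l, ins 1 ρ.1 m.1 l + convRaw 1 1 ρ.1 ρ.1 l = 0 := by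
  have h2 : (2 : k) ≠ 0 := two_ne_zero
  have e₁ : ∀ l, (hlrBracket (r := 1 + 1) rfl (m, ρ) (m, ρ)).1.1 l =
      (2 : k) • ins 1 m.1 m.1 l := by
    intro l
    change ins 1 m.1 m.1 l - Int.negOnePow (1 * 1) • ins 1 m.1 m.1 l = _
    rw [mul_one, Int.negOnePow_one, Units.neg_smul, one_smul, sub_neg_eq_add, two_smul]
  have e₂ : ∀ l, (hlrBracket (r := 1 + 1) rfl (m, ρ) (m, ρ)).2.1 l =
      (2 : k) • (ins 1 ρ.1 m.1 l + convRaw 1 1 ρ.1 ρ.1 l) := by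
    intro l
    change -(Int.negOnePow (1 * 1) • ins 1 ρ.1 m.1 l) -
      Int.negOnePow (1 * 1) • -(Int.negOnePow (1 * 1) • ins 1 ρ.1 m.1 l) +
      (convRaw 1 1 ρ.1 ρ.1 l - Int.negOnePow (1 * 1) • convRaw 1 1 ρ.1 ρ.1 l) = _
    simp only [mul_one, Int.negOnePow_one, Units.neg_smul, one_smul, sub_neg_eq_add, two_smul,
      neg_neg]
    abel
  constructor
  · intro h
    refine ⟨fun l => ?_, fun l => ?_⟩
    · have := e₁ l
      rw [h] at this
      exact (smul_eq_zero_iff_right h2).1 this.symm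
    · have := e₂ l
      rw [h] at this
      exact (smul_eq_zero_iff_right h2).1 this.symm
  · rintro ⟨h₁, h₂⟩
    refine Prod.ext (Subtype.ext (funext fun l => ?_)) (Subtype.ext (funext fun l => ?_))
    · rw [e₁, h₁, smul_zero]
      rfl
    · rw [e₂, h₂, smul_zero]
      rfl

theorem length_of_mem_blocks {W : ℤ → Type*} {j : ℕ} {l : List (H W)}
    {t : ℤˣ × List (List (H W))} (ht : t ∈ blocks j l) : t.2.length = j := by
  induction j generalizing l t with
  | zero =>
    rcases l with _ | ⟨a, l⟩
    · simp only [blocks, List.mem_singleton] at ht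
      simp [ht]
    · simp [blocks] at ht
  | succ j ih =>
    simp only [blocks, List.mem_flatMap, List.mem_map] at ht
    obtain ⟨t', -, b, hb, rfl⟩ := ht
    simp [ih hb]

theorem le_length_of_mem_blocks {W : ℤ → Type*} {j : ℕ} {l : List (H W)}
    {t : ℤˣ × List (List (H W))} (ht : t ∈ blocks j l) : j ≤ l.length := by
  induction j generalizing l t with
  | zero => exact Nat.zero_le _
  | succ j ih =>
    simp only [blocks, List.mem_flatMap, List.mem_map, List.mem_filter] at ht
    obtain ⟨t', ⟨ht', hne⟩, b, hb, rfl⟩ := ht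
    have h₁ := ih hb
    have h₂ := (perm_of_mem_splits ht').length_eq
    have h₃ : t'.2.1.length ≠ 0 := by simpa using hne
    rw [List.length_append] at h₂
    omega

theorem sum_blocks_zero {M : Type*} [AddCommGroup M] {W : ℤ → Type*}
    (G : List (List (H W)) → M) (l : List (H W)) :
    ((blocks 0 l).map fun t => t.1 • G t.2).sum = if l = [] then G [] else 0 := by
  rcases l with _ | ⟨a, l⟩ <;> simp [blocks]

theorem sum_blocks_succ {M : Type*} [AddCommGroup M] {W : ℤ → Type*}
    (G : List (List (H W)) → M) (j : ℕ) (l : List (H W)) :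
    ((blocks (j + 1) l).map fun t => t.1 • G t.2).sum =
      unshuffleSum (fun u v => if u = [] then 0 else
        ((blocks j v).map fun t => t.1 • G (u :: t.2)).sum) l := by
  rw [blocks, unshuffleSum]
  induction splits l with
  | nil => rfl
  | cons t s ih =>
    rw [List.map_cons, List.sum_cons, ← ih, List.filter_cons]
    by_cases h : t.2.1 = []
    · simp [h]
    · simp [h, List.smul_sum, Function.comp_def, mul_smul]

theorem sum_blocks_one {M : Type*} [AddCommGroup M] {W : ℤ → Type*}
    (G : List (List (H W)) → M) (h : G [[]] = 0) (l : List (H W)) :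
    ((blocks 1 l).map fun t => t.1 • G t.2).sum = G [l] := by
  rw [sum_blocks_succ, unshuffleSum_of_right_eq_nil]
  · rw [sum_blocks_zero (fun b => G (l :: b)), if_pos rfl]
    split_ifs with hl
    · rw [hl, h]
    · rfl
  · intro u v hv
    rw [sum_blocks_zero (fun b => G (u :: b)), if_neg hv, ite_self]

/-- The sum over unshuffles into two nonempty parts is the sum over all unshuffles, if the
summand vanishes when a part is empty. -/
theorem sum_blocks_two {M : Type*} [AddCommGroup M] {W : ℤ → Type*}
    (G : List (List (H W)) → M) (h₁ : ∀ v, G [[], v] = 0) (h₂ : ∀ u, G [u, []] = 0)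
    (l : List (H W)) :
    ((blocks 2 l).map fun t => t.1 • G t.2).sum = unshuffleSum (fun u v => G [u, v]) l := by
  rw [sum_blocks_succ]
  congr 1
  funext u v
  split_ifs with hu
  · rw [hu, h₁]
  · exact sum_blocks_one (fun b => G (u :: b)) (h₂ u) v

theorem glMul_zero_left {p q r : ℤ} (h : p + q = r) (z : Gl k V q) :
    glMul h (0 : Gl k V p) z = 0 :=
  Subtype.ext (funext fun _ => funext fun _ => LinearMap.zero_comp _)

theorem glMul_zero_right {p q r : ℤ} (h : p + q = r) (y : Gl k V p) :
    glMul h y (0 : Gl k V q) = 0 :=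
  Subtype.ext (funext fun _ => funext fun _ => LinearMap.comp_zero _)

theorem single_glMul_apply {p q r : ℤ} (h : p + q = r) (y : Gl k V p) (z : Gl k V q) :
    Pi.single (M := Gl k V) (p + q) (glMul rfl y z) r = glMul h y z := by
  subst h
  exact Pi.single_eq_same _ _

/-- `½ ∑_S ± [ρ(x_S), ρ(x_{Sᶜ})]` is, up to sign, the square of `ρ`: by graded symmetry both
terms of the commutator contribute the same. -/
theorem sum_blocks_glProducts (ρ : SHom k (Shift g 1) (Gl k V) 1) (l : List (H (Shift g 1)))
    (j : ℤ) :
    ((blocks 2 l).map (fun t => t.1 • glProducts k V (t.2.map (fun b =>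
        (⟨deg b, (desuspend ρ).1 b (deg b)⟩ : H (Shift (Gl k V) 1)))))).sum j =
      -((2 : k) • convRaw 1 1 ρ.1 ρ.1 l (j + 1)) := by
  have hρ : ∀ d, ρ.1 [] d = 0 := congrFun ρ.2.1
  rw [sum_blocks_two (fun bs => glProducts k V (bs.map (fun b =>
    (⟨deg b, (desuspend ρ).1 b (deg b)⟩ : H (Shift (Gl k V) 1)))))]
  rotate_left
  · intro v
    simp [glProducts, desuspend, glBracket, hρ, glMul_zero_left, glMul_zero_right]
  · intro u
    simp [glProducts, desuspend, glBracket, hρ, glMul_zero_left, glMul_zero_right]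
  let C : List (H (Shift g 1)) → List (H (Shift g 1)) → Gl k V (j + 1) := fun u v =>
    Pi.single (M := Gl k V) ((deg u + 1) + (deg v + 1))
      (glMul rfl (ρ.1 u (deg u + 1)) (ρ.1 v (deg v + 1))) (j + 1)
  let F : List (H (Shift g 1)) → List (H (Shift g 1)) → Gl k V (j + 1) := fun u v =>
    (-1 : ℤˣ) • Int.negOnePow (1 * deg u) • C u v
  have hF : ∀ u v, glProducts k V [⟨deg u, ρ.1 u (deg u + 1)⟩, ⟨deg v, ρ.1 v (deg v + 1)⟩] j =
      F u v + Int.negOnePow (deg u * deg v) • F v u := by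
    intro u v
    by_cases hj : j = deg u + deg v + 1
    · subst hj
      have h₁ : C u v = glMul (by ring) (ρ.1 u (deg u + 1)) (ρ.1 v (deg v + 1)) :=
        single_glMul_apply _ _ _
      have h₂ : C v u = glMul (by ring) (ρ.1 v (deg v + 1)) (ρ.1 u (deg u + 1)) :=
        single_glMul_apply _ _ _
      simp only [F, h₁, h₂]
      refine (Pi.single_eq_same (M := Shift (Gl k V) 1) _ _).trans ?_
      rw [glBracket, smul_sub, sub_eq_add_neg, ← neg_one_units_smul]
      simp only [smul_smul, one_mul]
      congr 2
      · rw [Int.negOnePow_succ, neg_one_mul]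
      · -- `1 + (|u| + 1) + (|u| + 1) (|v| + 1)` and `|u| |v| + 1 + |v|` have the same parity.
        rw [← Int.negOnePow_one]
        simp only [← Int.negOnePow_add]
        rw [Int.negOnePow_eq_iff]
        exact ⟨deg u + 1, by ring⟩
    · have h₁ : C u v = 0 := Pi.single_eq_of_ne (by omega) _
      have h₂ : C v u = 0 := Pi.single_eq_of_ne (by omega) _
      simp only [F, h₁, h₂, smul_zero, add_zero]
      exact Pi.single_eq_of_ne hj _
  rw [unshuffleSum_apply]
  refine (congrArg (fun F => unshuffleSum F l) (funext fun u => funext fun v => hF u v)).trans ?_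
  rw [unshuffleSum_add, ← unshuffleSum_comm, unshuffleSum_units_smul, neg_one_units_smul,
    ← neg_add, ← two_smul k, convRaw, unshuffleSum_apply]
  rfl

/-- `ρ` is a representation iff it satisfies the Maurer-Cartan equation `m · ρ + ½ [ρ, ρ] = 0`,
where `m · ρ = ρ ∘ m` and `½ [ρ, ρ]` is the square of `ρ`. -/
theorem isRepresentation_iff [CharZero k] (m : SHom k (Shift g 1) (Shift g 1) 1)
    (ρ : SHom k (Shift g 1) (Gl k V) 1) :
    IsRepresentation m ρ ↔ ∀ l, ins 1 ρ.1 m.1 l + convRaw 1 1 ρ.1 ρ.1 l = 0 := by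
  have h2 : (2 : k) ≠ 0 := two_ne_zero
  have hins : ∀ l j, ins 1 (desuspend ρ).1 m.1 l j = ins 1 ρ.1 m.1 l (j + 1) := by
    intro l j
    rw [ins, ins, unshuffleSum_apply, unshuffleSum_apply]
    rfl
  have hsum : ∀ (l : List (H (Shift g 1))) (j : ℤ), (∑ i ∈ Finset.Icc 1 l.length,
      ((i.factorial : k)⁻¹) • ((blocks i l).map (fun t => t.1 • glProducts k V (t.2.map (fun b =>
        (⟨deg b, (desuspend ρ).1 b (deg b)⟩ : H (Shift (Gl k V) 1)))))).sum) j =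
      -convRaw 1 1 ρ.1 ρ.1 l (j + 1) := by
    intro l j
    rw [Finset.sum_eq_single 2]
    · rw [Pi.smul_apply, sum_blocks_glProducts, smul_neg, Nat.factorial_two, Nat.cast_ofNat,
        inv_smul_smul₀ h2]
    · intro i _ hi
      rw [List.sum_eq_zero, smul_zero]
      intro x hx
      obtain ⟨t, ht, rfl⟩ := List.mem_map.1 hx
      have hlen := length_of_mem_blocks ht
      rcases t with ⟨s, _ | ⟨a, _ | ⟨b, _ | ⟨c, u⟩⟩⟩⟩
      · exact smul_zero _
      · exact smul_zero _
      · exact absurd hlen.symm hi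
      · exact smul_zero _
    · intro hl
      rw [List.sum_eq_zero, smul_zero]
      intro x hx
      obtain ⟨t, ht, rfl⟩ := List.mem_map.1 hx
      exact absurd (Finset.mem_Icc.2 ⟨one_le_two, le_length_of_mem_blocks ht⟩) hl
  constructor
  · intro h l
    rcases eq_or_ne l [] with rfl | hl
    · rw [(ins_mem (r := 1 + 1) rfl ρ.2 m.2).1, (convRaw_mem (r := 1 + 1) rfl ρ.2 ρ.2).1, add_zero]
    · funext j
      obtain ⟨j, rfl⟩ : ∃ i, j = i + 1 := ⟨j - 1, by ring⟩
      have := congrFun (h l hl) j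
      rw [hins, hsum] at this
      rw [Pi.add_apply, this, neg_add_cancel]
      rfl
  · intro h l _
    funext j
    rw [hins, hsum]
    exact eq_neg_of_add_eq_zero_left (congrFun (h l) (j + 1))

end Main

end HRB

theorem theorem4p6 {k : Type*} [Field k] [CharZero k] (g V : ℤ → Type*)
    [∀ i, AddCommGroup (g i)] [∀ i, Module k (g i)]
    [∀ i, AddCommGroup (V i)] [∀ i, Module k (V i)]
    (m : HRB.SHom k (HRB.Shift g 1) (HRB.Shift g 1) 1)
    (ρ : HRB.SHom k (HRB.Shift g 1) (HRB.Gl k V) 1)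
    (T : HRB.SHom k (HRB.Shift V 1) (HRB.Shift g 1) 0) :
    HRB.IsHomotopyRelativeRBLieAlgebra m ρ T ↔
      HRB.IsMC (HRB.hrbFiltration k g V) (HRB.hrbProducts k g V) ((m, ρ), T) := by
  rw [HRB.isMC_iff, HRB.hlrBracket_self_eq_zero_iff, ← HRB.isRepresentation_iff,
    ← HRB.isHomotopyRelativeRBOperator_iff]
  exact ⟨fun h => ⟨⟨h.1, h.2⟩, h.3⟩, fun h => ⟨h.1.1, h.1.2, h.2⟩⟩
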